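/- All vector spaces are real. Let $\mathbb S$ be the unit circle group and $\mathbb S_+=\{z\in\mathbb S:\operatorname{Re} z\ge 0\}$. For an abelian topological group $(G,\tau)$ let $G^*$ be the group of all homomorphisms $G\to\mathbb S$ (written additively) and $\widehat G\subseteq G^*$ the subgroup of the continuous ones, endowed with the topology $\sigma(\widehat G,G)$ of pointwise convergence on $G$. A set $A\subseteq G$ is quasi-convex if for every $g\in G\setminus A$ there is $\chi\in\widehat G$ with $\chi(g)\notin\mathbb S_+$ and $\chi(A)\subseteq\mathbb S_+$; $(G,\tau)$ is locally quasi-convex (lqc) if the quasi-convex neighborhoods of $0$ form a neighborhood base at $0$. An lqc group $(G,\tau)$ is a Mackey group if $\nu\le\tau$ for every lqc group topology $\nu$ on $G$ with $\widehat{(G,\nu)}=\widehat{(G,\tau)}$. For $B\subseteq\widehat G$ put $B^{\triangleleft}=\{g\in G:\chi(g)\in\mathbb S_+\ \text{for all}\ \chi\in B\}$, and for $A\subseteq G$ put $A^{\blacktriangleright}=\{\chi\in G^*:\chi(A)\subseteq\mathbb S_+\}$. Let $\mathrm{Mac}(G)$ be the family of all quasi-convex compact subsets $K$ of the topological group $(\widehat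 G,\sigma(\widehat G,G))$ such that $\big((n)K+F\big)^{\triangleleft\blacktriangleright}\subseteq\widehat G$ for every $n\ge 1$ and every finite $F\subseteq\widehat G$ with $0\in F$, where $(n)K=K+\cdots+K$ ($n$ summands). Let $(E,\mu)$ be a locally convex space with topological dual $E'$. It is a Mackey space if $\mu$ is the finest locally convex vector topology $\nu$ on $E$ with $(E,\nu)'=(E,\mu)'$. Let $\mathcal{CAC}(E')$ be the family of all $\sigma(E',E)$-compact absolutely convex subsets of $E'$ and let $\psi:E'\to\widehat E$, $\psi(\chi)=e^{2\pi i\chi}$. **Theorem.** A locally convex space $(E,\mu)$ is a Mackey group (as an additive topological group) if and only if it is a Mackey space and the family $\psi(\mathcal{CAC}(E'))=\{\psi(K):K\in\mathcal{CAC}(E')\}$ swallows $\mathrm{Mac}(E)$, i.e. for every $C\in\mathrm{Mac}(E)$ there is $K\in\mathcal{CAC}(E')$ with $C\subseteq\psi(K)$. -/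

import Mathlib

open scoped Pointwise

namespace MackeyGroup

/-- The right half `𝕊₊ = {z ∈ 𝕊 : Re z ≥ 0}` of the unit circle. -/
def circlePlus : Set Circle := {z | 0 ≤ (z : ℂ).re}

section Groups

variable {G : Type*} [AddCommGroup G]

/-- The dual group `Ĝ` of the abelian topological group `(G, τ)`: the subgroup of all `τ`-continuous
characters in the group `G* = AddChar G Circle` of all characters of `G`, which is written
additively: `(χ + η) g = χ g * η g`. -/
def contDual (τ : TopologicalSpace G) : AddSubgroup (AddChar G Circle) where
  carrier := {χ | @Continuous G Circle τ _ χ}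
  zero_mem' := by
    let _ := τ
    change Continuous fun _ : G => (1 : Circle)
    exact continuous_const
  add_mem' := by
    intro χ η hχ hη
    let _ := τ
    have h1 : Continuous (χ : G → Circle) := hχ
    have h2 : Continuous (η : G → Circle) := hη
    change Continuous fun g : G => χ g * η g
    exact h1.mul h2
  neg_mem' := by
    intro χ hχ
    let _ := τ
    have h1 : Continuous (χ : G → Circle) := hχ
    have h2 : ((-χ : AddChar G Circle) : G → Circle) = fun g => χ (-g) := by
      funext g
      exact AddChar.neg_apply χ g
    change Continuous ((-χ : AddChar G Circle) : G → Circle)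
    rw [h2]
    have h3 : (fun g => χ (-g)) = fun g => (χ g)⁻¹ := by
      funext g
      exact AddChar.map_neg_eq_inv χ g
    rw [h3]
    exact h1.inv

/-- The weak-star topology `σ(Ĝ, G)` on `Ĝ`: the weakest topology for which every evaluation
`χ ↦ χ g`, `g ∈ G`, is continuous. -/
@[reducible] noncomputable def weakStar (τ : TopologicalSpace G) : TopologicalSpace (contDual τ) :=
  TopologicalSpace.induced (fun (χ : contDual τ) (g : G) => (χ : AddChar G Circle) g) inferInstance

/-- A subset `A` of the abelian topological group `(G, τ)` is quasi-convex if every point outside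
`A` is separated from `A` by a continuous character. -/
def IsQuasiConvex (τ : TopologicalSpace G) (A : Set G) : Prop :=
  ∀ g, g ∉ A → ∃ χ ∈ contDual τ, χ g ∉ circlePlus ∧ ∀ a ∈ A, χ a ∈ circlePlus

/-- `τ` is a locally quasi-convex group topology on the abelian group `G`. -/
structure IsLQC (τ : TopologicalSpace G) : Prop where
  isTopologicalAddGroup : @IsTopologicalAddGroup G τ _
  quasiConvex_basis : ∀ V ∈ @nhds G τ 0, ∃ U ∈ @nhds G τ 0, IsQuasiConvex τ U ∧ U ⊆ V

/-- `(G, τ)` is a Mackey group: it is locally quasi-convex, and `τ` is finer than every locally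
quasi-convex group topology `ν` on `G` with the same continuous characters.
(In Mathlib's order on topologies, `τ ≤ ν` means that `τ` is finer than `ν`.) -/
def IsMackeyGroup (τ : TopologicalSpace G) : Prop :=
  IsLQC τ ∧ ∀ ν : TopologicalSpace G, IsLQC ν → contDual ν = contDual τ → τ ≤ ν

/-- The inverse polar `B◁ ⊆ G` of a set `B ⊆ Ĝ`. -/
def invPolar {τ : TopologicalSpace G} (B : Set (contDual τ)) : Set G :=
  {g | ∀ χ ∈ B, (χ : AddChar G Circle) g ∈ circlePlus}

/-- The polar `A▶` of a set `A ⊆ G` in the group `G*` of all characters of `G`. -/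
def algPolar (A : Set G) : Set (AddChar G Circle) :=
  {χ | ∀ g ∈ A, χ g ∈ circlePlus}

/-- The `n`-fold sum `(n)A = A + ⋯ + A`. -/
def nfoldSum (A : Set G) : ℕ → Set G
  | 0 => {0}
  | n + 1 => nfoldSum A n + A

/-- The family `Mac(G)` of all quasi-convex compact subsets `K` of `(Ĝ, σ(Ĝ, G))` such that
`((n)K + F)◁▶ ⊆ Ĝ` for every `n ≥ 1` and every finite `F ⊆ Ĝ` containing `0`. -/
def Mac (τ : TopologicalSpace G) : Set (Set (contDual τ)) :=
  {K | IsQuasiConvex (weakStar τ) K ∧ @IsCompact (contDual τ) (weakStar τ) K ∧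
    ∀ F : Set (contDual τ), F.Finite → 0 ∈ F → ∀ n : ℕ, 1 ≤ n →
      algPolar (invPolar (nfoldSum K n + F)) ⊆ (contDual τ : Set (AddChar G Circle))}

end Groups

/-- The family `ℬ` swallows the family `𝒜`. -/
def Swallows {Ω : Type*} (ℬ 𝒜 : Set (Set Ω)) : Prop :=
  ∀ A ∈ 𝒜, ∃ B ∈ ℬ, A ⊆ B

section Spaces

variable {E : Type*} [AddCommGroup E] [Module ℝ E]

/-- `τ` is a locally convex vector topology on the real vector space `E`. -/
structure IsLocallyConvexTopology (τ : TopologicalSpace E) : Prop where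
  isTopologicalAddGroup : @IsTopologicalAddGroup E τ _
  continuousSMul : @ContinuousSMul ℝ E _ _ τ
  locallyConvexSpace : @LocallyConvexSpace ℝ E _ _ _ _ τ

/-- The locally convex topology `τ` is the Mackey topology: it is the finest one among the locally
convex vector topologies on `E` which have the same continuous linear functionals as `τ`. -/
def IsMackeySpace (τ : TopologicalSpace E) : Prop :=
  IsLocallyConvexTopology τ ∧
    ∀ ν : TopologicalSpace E, IsLocallyConvexTopology ν →
      (∀ f : E →ₗ[ℝ] ℝ, @Continuous E ℝ ν _ f ↔ @Continuous E ℝ τ _ f) → τ ≤ ν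

/-- The family of all `σ(E', E)`-compact absolutely convex subsets of the dual `E'`
(`WeakDual ℝ E` is `E'` with the topology `σ(E', E)`). -/
def CAC (E : Type*) [AddCommGroup E] [Module ℝ E] [TopologicalSpace E] : Set (Set (WeakDual ℝ E)) :=
  {K | IsCompact K ∧ AbsConvex ℝ K}

/-- The canonical map `ψ : E' → Ê`, `ψ(χ) = e^{2πiχ}`. -/
noncomputable def psi [τ : TopologicalSpace E] (f : WeakDual ℝ E) : contDual τ :=
  ⟨{ toFun := fun x => Circle.exp (2 * Real.pi * f x)
     map_zero_eq_one' := by simp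
     map_add_eq_mul' := fun x y => by simp [mul_add, Circle.exp_add] },
   Circle.exp.continuous.comp (continuous_const.mul (map_continuous f))⟩

end Spaces

end MackeyGroup

open Filter Topology

namespace MackeyGroup

/-! The pivot is a group-level criterion: a locally quasi-convex group is Mackey iff `invPolar K` is
a neighborhood of `0` for every `K ∈ Mac τ`. If the group is Mackey, the sets `((n)K + F)◁` generate
a locally quasi-convex topology with the same dual, hence one coarser than `τ`
(`invPolar_mem_nhds_of_mem_Mac`). Conversely, polars of neighborhoods in a compatible group topology
lie in `Mac` (`polar_mem_Mac`), and quasi-convex sets are recovered from their polars.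

On `E`, continuous characters lift to continuous functionals
(`exists_linearMap_of_continuous_addChar`), so compatibility means the same for characters and for
functionals, and a Mackey group is a Mackey space. If `K◁` contains a balanced neighborhood `U`, the
lifts of `K` are bounded by `1/4` on `U`, and Alaoglu's theorem yields the swallowing set.
Conversely, in a Mackey space each nonempty `C ∈ CAC E` is equicontinuous
(`eventually_abs_le_of_mem_CAC`), so inverse polars of sets inside `ψ(C)` are neighborhoods of `0`.
-/

theorem mul_mem_circlePlus {z w : Circle} (hz : z ∈ circlePlus) (hz2 : z ^ 2 ∈ circlePlus)
    (hw : w ∈ circlePlus) (hw2 : w ^ 2 ∈ circlePlus) : z * w ∈ circlePlus := by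
  -- The two conditions confine `u` to the sector `|arg u| ≤ π/4`.
  have key : ∀ u : Circle, u ∈ circlePlus → u ^ 2 ∈ circlePlus →
      |(u : ℂ).im| ≤ (u : ℂ).re := by
    intro u hu hu2
    simp only [circlePlus, Set.mem_ofPred_eq] at hu hu2
    rw [Circle.coe_pow, pow_two, Complex.mul_re] at hu2
    exact abs_le_of_sq_le_sq (by nlinarith) hu
  have h := mul_le_mul (key z hz hz2) (key w hw hw2) (abs_nonneg _) hz
  rw [← abs_mul] at h
  have h' := le_abs_self ((z : ℂ).im * (w : ℂ).im)
  simp only [circlePlus, Set.mem_ofPred_eq, Circle.coe_mul, Complex.mul_re]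
  linarith

/-- Since `1 - Re z² = 2 (1 - Re z)(1 + Re z)`, each squaring that stays in `𝕊₊` halves the bound on
`1 - Re z`; finally `‖z - 1‖² = 2 (1 - Re z)`. -/
theorem norm_sub_one_sq_le {k : ℕ} {z : Circle} (h : ∀ j ≤ k, z ^ 2 ^ j ∈ circlePlus) :
    ‖(z : ℂ) - 1‖ ^ 2 ≤ 2 * (1 / 2) ^ k := by
  have hsq : ∀ u : Circle, (u : ℂ).re ^ 2 + (u : ℂ).im ^ 2 = 1 := by
    intro u
    have := Circle.normSq_coe u
    rw [Complex.normSq_apply] at this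
    linarith
  have key : ∀ k : ℕ, ∀ z : Circle, (∀ j ≤ k, z ^ 2 ^ j ∈ circlePlus) →
      1 - (z : ℂ).re ≤ (1 / 2) ^ k := by
    intro k
    induction k with
    | zero =>
      intro z h
      have h0 := h 0 le_rfl
      simp only [circlePlus, Set.mem_ofPred_eq, pow_zero, pow_one] at h0 ⊢
      linarith
    | succ k ih =>
      intro z h
      have h1 := ih (z ^ 2) fun j hj => by
        rw [← pow_mul, ← pow_succ']
        exact h (j + 1) (by omega)
      have h0 := h 0 (by omega)
      simp only [circlePlus, Set.mem_ofPred_eq, pow_zero, pow_one] at h0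
      have h2 := hsq z
      rw [Circle.coe_pow, pow_two, Complex.mul_re] at h1
      rw [pow_succ]
      nlinarith
  have h1 := key k z h
  have h2 := hsq z
  rw [← Complex.normSq_eq_norm_sq, Complex.normSq_apply]
  simp only [Complex.sub_re, Complex.one_re, Complex.sub_im, Complex.one_im]
  nlinarith

theorem exists_forall_pow_mem_circlePlus {W : Set Circle} (hW : W ∈ 𝓝 (1 : Circle)) :
    ∃ k : ℕ, ∀ z : Circle, (∀ j ≤ k, z ^ 2 ^ j ∈ circlePlus) → z ∈ W := by
  obtain ⟨ε, hε, hball⟩ := Metric.mem_nhds_iff.1 hW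
  obtain ⟨k, hk⟩ := exists_pow_lt_of_lt_one (show 0 < ε ^ 2 / 2 by positivity)
    (show (1 / 2 : ℝ) < 1 by norm_num)
  refine ⟨k, fun z hz => hball ?_⟩
  have h := norm_sub_one_sq_le hz
  change dist (z : ℂ) ((1 : Circle) : ℂ) < ε
  rw [Circle.coe_one, dist_eq_norm]
  exact lt_of_pow_lt_pow_left₀ 2 hε.le (by linarith)

theorem circlePlus_mem_nhds : circlePlus ∈ 𝓝 (1 : Circle) := by
  have h : Continuous fun z : Circle => (z : ℂ).re :=
    Complex.continuous_re.comp continuous_subtype_val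
  have := h.continuousAt.eventually (lt_mem_nhds (show (0 : ℝ) < ((1 : Circle) : ℂ).re by simp))
  filter_upwards [this] with z hz using hz.le

theorem one_mem_circlePlus : (1 : Circle) ∈ circlePlus := by
  simp [circlePlus]

theorem isClosed_circlePlus : IsClosed circlePlus :=
  isClosed_le continuous_const (Complex.continuous_re.comp continuous_subtype_val)

theorem inv_mem_circlePlus {z : Circle} (hz : z ∈ circlePlus) : z⁻¹ ∈ circlePlus := by
  simpa [circlePlus, Circle.coe_inv_eq_conj] using hz

/-! ### Characters of topological groups and the Mackey criterion -/

section Groups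

variable {G : Type*} [AddCommGroup G]

/-- Finitely many doublings `x ↦ 2 ^ j • x`, all continuous at `0`, turn the single set `𝕊₊` into a
test for equicontinuity. -/
theorem eventually_of_eventually_circlePlus [TopologicalSpace G] [IsTopologicalAddGroup G]
    {ι : Type*} {e : ι → AddChar G Circle} (h : ∀ᶠ x in 𝓝 (0 : G), ∀ i, e i x ∈ circlePlus)
    {W : Set Circle} (hW : W ∈ 𝓝 (1 : Circle)) : ∀ᶠ x in 𝓝 (0 : G), ∀ i, e i x ∈ W := by
  obtain ⟨k, hk⟩ := exists_forall_pow_mem_circlePlus hW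
  have h1 : ∀ j ∈ Finset.range (k + 1), ∀ᶠ x in 𝓝 (0 : G), ∀ i, e i (2 ^ j • x) ∈ circlePlus := by
    intro j _
    have : Tendsto (fun x : G => 2 ^ j • x) (𝓝 0) (𝓝 0) := by
      simpa using ((continuous_nsmul (M := G) (2 ^ j)).tendsto 0)
    exact this.eventually h
  filter_upwards [(Filter.eventually_all_finset _).2 h1] with x hx i
  refine hk _ fun j hj => ?_
  rw [← AddChar.map_nsmul_eq_pow]
  exact hx j (by simp; omega) i

theorem continuous_addChar [TopologicalSpace G] [IsTopologicalAddGroup G] {χ : AddChar G Circle}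
    (h : ∀ᶠ x in 𝓝 (0 : G), χ x ∈ circlePlus) : Continuous χ := by
  have h1 : Continuous χ.toAddMonoidHom := by
    refine continuous_of_continuousAt_zero _ ?_
    rw [ContinuousAt, map_zero]
    intro W hW
    have := eventually_of_eventually_circlePlus (e := fun _ : Unit => χ) (by simpa using h)
      (W := W) hW
    simp only [forall_const] at this
    exact this
  exact h1

theorem mem_contDual {τ : TopologicalSpace G} {χ : AddChar G Circle} :
    χ ∈ contDual τ ↔ @Continuous G Circle τ _ χ := Iff.rfl

theorem eventually_circlePlus_of_mem_contDual [τ : TopologicalSpace G] {χ : AddChar G Circle}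
    (h : χ ∈ contDual τ) : ∀ᶠ x in 𝓝 (0 : G), χ x ∈ circlePlus := by
  have h' : Continuous χ := h
  exact h'.continuousAt.eventually (by simpa using circlePlus_mem_nhds)

theorem isQuasiConvex_invPolar {τ ν : TopologicalSpace G} (h : contDual τ ≤ contDual ν)
    (B : Set (contDual τ)) : IsQuasiConvex ν (invPolar B) := by
  intro g hg
  simp only [invPolar, Set.mem_ofPred_eq, not_forall] at hg
  obtain ⟨χ, hχ, hg⟩ := hg
  exact ⟨χ, h χ.2, hg, fun a ha => ha χ hχ⟩

/-! ### The topology of uniform convergence on the members of `Mac` -/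

/-- The group filter basis given by the inverse polars of a family of sets of characters that
contain `0` and such that the sum of any two members is contained in a member. -/
@[reducible] def polarBasis {τ : TopologicalSpace G} (𝓑 : Set (Set (contDual τ))) (hne : 𝓑.Nonempty)
    (hzero : ∀ B ∈ 𝓑, (0 : contDual τ) ∈ B)
    (hadd : ∀ B ∈ 𝓑, ∀ C ∈ 𝓑, ∃ D ∈ 𝓑, B + C ⊆ D) : AddGroupFilterBasis G where
  sets := {V | ∃ B ∈ 𝓑, V = invPolar B}
  nonempty := hne.imp' invPolar fun B hB => ⟨B, hB, rfl⟩
  inter_sets := by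
    rintro _ _ ⟨B, hB, rfl⟩ ⟨C, hC, rfl⟩
    obtain ⟨D, hD, hBCD⟩ := hadd B hB C hC
    refine ⟨_, ⟨D, hD, rfl⟩, fun x hx => ⟨fun χ hχ => hx χ (hBCD ?_), fun χ hχ => hx χ (hBCD ?_)⟩⟩
    · simpa using Set.add_mem_add hχ (hzero C hC)
    · simpa using Set.add_mem_add (hzero B hB) hχ
  zero' := by
    rintro _ ⟨B, hB, rfl⟩ χ _
    simpa using one_mem_circlePlus
  add' := by
    rintro _ ⟨B, hB, rfl⟩
    -- `D` contains both `χ` and `χ + χ` for `χ ∈ B`, so on `D◁` the values of `χ` and their squares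
    -- lie in `𝕊₊`, as `mul_mem_circlePlus` requires.
    obtain ⟨D, hD, hBD⟩ := hadd B hB B hB
    refine ⟨_, ⟨D, hD, rfl⟩, ?_⟩
    rintro _ ⟨x, hx, y, hy, rfl⟩ χ hχ
    have h1 : χ ∈ D := hBD (by simpa using Set.add_mem_add hχ (hzero B hB))
    have h2 : χ + χ ∈ D := hBD (Set.add_mem_add hχ hχ)
    have h3 : ∀ z : G, ((χ + χ : contDual τ) : AddChar G Circle) z =
        ((χ : AddChar G Circle) z) ^ 2 := fun z => (sq _).symm
    simp only [AddChar.map_add_eq_mul]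
    exact mul_mem_circlePlus (hx χ h1) (h3 x ▸ hx _ h2) (hy χ h1) (h3 y ▸ hy _ h2)
  neg' := by
    rintro _ ⟨B, hB, rfl⟩
    refine ⟨_, ⟨B, hB, rfl⟩, fun x hx χ hχ => ?_⟩
    rw [AddChar.map_neg_eq_inv]
    exact inv_mem_circlePlus (hx χ hχ)
  conj' := by
    rintro x₀ _ ⟨B, hB, rfl⟩
    exact ⟨_, ⟨B, hB, rfl⟩, fun x hx => by simpa using hx⟩

theorem nfoldSum_add {A : Set G} (m n : ℕ) : nfoldSum A m + nfoldSum A n = nfoldSum A (m + n) := by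
  induction n with
  | zero => simp [nfoldSum]
  | succ n ih => rw [← Nat.add_assoc, nfoldSum, nfoldSum, ← add_assoc, ih]

theorem zero_mem_nfoldSum {A : Set G} (h : (0 : G) ∈ A) (n : ℕ) : (0 : G) ∈ nfoldSum A n := by
  induction n with
  | zero => simp [nfoldSum]
  | succ n ih => simpa [nfoldSum] using Set.add_mem_add ih h

theorem zero_mem_of_isQuasiConvex {τ : TopologicalSpace G} {A : Set G} (h : IsQuasiConvex τ A) :
    (0 : G) ∈ A := by
  by_contra h0
  obtain ⟨χ, -, hχ, -⟩ := h 0 h0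
  exact hχ (by simpa using one_mem_circlePlus)

/-- The topology with basis `((n)K + F)◁` at `0` gains no characters, by the polar condition in
`Mac`, and loses none, because `F` may contain any given `χ`. Being Mackey, `τ` is finer. -/
theorem invPolar_mem_nhds_of_mem_Mac [τ : TopologicalSpace G] (hτ : IsMackeyGroup τ)
    {K : Set (contDual τ)} (hK : K ∈ Mac τ) : invPolar K ∈ 𝓝 (0 : G) := by
  obtain ⟨hqc, -, hK⟩ := hK
  have hK0 := zero_mem_of_isQuasiConvex hqc
  let 𝓑 : Set (Set (contDual τ)) :=
    {B | ∃ F : Set (contDual τ), F.Finite ∧ 0 ∈ F ∧ ∃ n : ℕ, 1 ≤ n ∧ B = nfoldSum K n + F}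
  have hne : 𝓑.Nonempty := ⟨_, {0}, by simp, by simp, 1, le_rfl, rfl⟩
  have hzero : ∀ B ∈ 𝓑, (0 : contDual τ) ∈ B := by
    rintro _ ⟨F, -, hF0, n, -, rfl⟩
    simpa using Set.add_mem_add (zero_mem_nfoldSum hK0 n) hF0
  have hadd : ∀ B ∈ 𝓑, ∀ C ∈ 𝓑, ∃ D ∈ 𝓑, B + C ⊆ D := by
    rintro _ ⟨F, hF, hF0, n, hn, rfl⟩ _ ⟨F', hF', hF0', n', hn', rfl⟩
    refine ⟨_, ⟨F + F', hF.add hF', by simpa using Set.add_mem_add hF0 hF0', n + n', by omega,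
      rfl⟩, ?_⟩
    rw [← nfoldSum_add, add_add_add_comm]
  let 𝓕 := polarBasis 𝓑 hne hzero hadd
  let ν : TopologicalSpace G := 𝓕.topology
  have hνgrp : @IsTopologicalAddGroup G ν _ := 𝓕.isTopologicalAddGroup
  have hmem : ∀ B ∈ 𝓑, invPolar B ∈ @nhds G ν 0 := fun B hB =>
    𝓕.mem_nhds_zero ⟨B, hB, rfl⟩
  have hbasis : ∀ V ∈ @nhds G ν 0, ∃ B ∈ 𝓑, invPolar B ⊆ V := by
    intro V hV
    obtain ⟨_, ⟨B, hB, rfl⟩, hBV⟩ := (𝓕.nhds_zero_hasBasis.mem_iff).1 hV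
    exact ⟨B, hB, hBV⟩
  have hdual : contDual ν = contDual τ := by
    refine le_antisymm (fun χ hχ => ?_) (fun χ hχ => ?_)
    · obtain ⟨_, ⟨F, hF, hF0, n, hn, rfl⟩, hB⟩ :=
        hbasis _ (@eventually_circlePlus_of_mem_contDual G _ ν χ hχ)
      exact hK F hF hF0 n hn fun g hg => hB hg
    · refine @continuous_addChar G _ ν hνgrp χ ?_
      refine mem_of_superset (hmem _ ⟨{0, ⟨χ, hχ⟩}, by simp, by simp, 1, le_rfl, rfl⟩) ?_
      intro x hx
      refine hx ⟨χ, hχ⟩ ?_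
      simpa using Set.add_mem_add (zero_mem_nfoldSum hK0 1)
        (show (⟨χ, hχ⟩ : contDual τ) ∈ ({0, ⟨χ, hχ⟩} : Set (contDual τ)) by simp)
  have hlqc : IsLQC ν := ⟨hνgrp, fun V hV => by
    obtain ⟨B, hB, hBV⟩ := hbasis V hV
    exact ⟨_, hmem B hB, isQuasiConvex_invPolar hdual.ge B, hBV⟩⟩
  have hle : τ ≤ ν := hτ.2 ν hlqc hdual
  refine (nhds_mono hle : @nhds G τ 0 ≤ @nhds G ν 0) ?_
  have := hmem _ ⟨{0}, by simp, by simp, 1, le_rfl, rfl⟩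
  simpa [nfoldSum] using this

/-! ### Polars of neighborhoods belong to `Mac` -/

/-- In the compact product `G → Circle` the conditions are closed, and a homomorphism mapping `U`
into `𝕊₊` is automatically `ν`-continuous, so no limit leaves the dual. -/
theorem isCompact_polar {τ ν : TopologicalSpace G}
    (hν : @IsTopologicalAddGroup G ν _) (hdual : contDual ν = contDual τ) {U : Set G}
    (hU : U ∈ @nhds G ν 0) :
    @IsCompact (contDual τ) (weakStar τ) {χ | ∀ g ∈ U, (χ : AddChar G Circle) g ∈ circlePlus} := by
  let _ : TopologicalSpace (contDual τ) := weakStar τ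
  have hind : IsInducing (fun (χ : contDual τ) (g : G) => (χ : AddChar G Circle) g) := ⟨rfl⟩
  rw [hind.isCompact_iff]
  have himage : (fun (χ : contDual τ) (g : G) => (χ : AddChar G Circle) g) ''
      {χ | ∀ g ∈ U, (χ : AddChar G Circle) g ∈ circlePlus} =
      {φ : G → Circle | φ 0 = 1} ∩ ((⋂ (x) (y), {φ : G → Circle | φ (x + y) = φ x * φ y}) ∩
        ⋂ g ∈ U, {φ : G → Circle | φ g ∈ circlePlus}) := by
    ext φ
    simp only [Set.mem_image, Set.mem_ofPred_eq, Set.mem_inter_iff, Set.mem_iInter]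
    constructor
    · rintro ⟨χ, hχ, rfl⟩
      exact ⟨AddChar.map_zero_eq_one _, AddChar.map_add_eq_mul _, hχ⟩
    · rintro ⟨h0, hadd, hU'⟩
      let χ : AddChar G Circle := ⟨φ, h0, hadd⟩
      have hχ : χ ∈ contDual τ := by
        rw [← hdual]
        exact @continuous_addChar G _ ν hν χ (mem_of_superset hU fun g hg => hU' g hg)
      exact ⟨⟨χ, hχ⟩, hU', rfl⟩
  rw [himage]
  refine IsClosed.isCompact ?_
  refine (isClosed_eq (continuous_apply _) continuous_const).inter (IsClosed.inter ?_ ?_)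
  · refine isClosed_iInter fun x => isClosed_iInter fun y => ?_
    exact isClosed_eq (continuous_apply _) ((continuous_apply x).mul (continuous_apply y))
  · exact isClosed_biInter fun g _ => isClosed_circlePlus.preimage (continuous_apply g)

/-- Evaluation at `g` as a character of the dual group. -/
noncomputable def evalChar (τ : TopologicalSpace G) (g : G) : AddChar (contDual τ) Circle where
  toFun χ := (χ : AddChar G Circle) g
  map_zero_eq_one' := rfl
  map_add_eq_mul' _ _ := rfl

theorem evalChar_mem (τ : TopologicalSpace G) (g : G) : evalChar τ g ∈ contDual (weakStar τ) := by
  let _ : TopologicalSpace (contDual τ) := weakStar τ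
  exact (continuous_apply g).comp continuous_induced_dom

/-- The set `B` of characters is equicontinuous with respect to the group topology `ν`. -/
def IsEquicontinuous (ν : TopologicalSpace G) {τ : TopologicalSpace G} (B : Set (contDual τ)) :
    Prop :=
  ∀ W ∈ 𝓝 (1 : Circle), ∀ᶠ x in @nhds G ν 0, ∀ χ ∈ B, (χ : AddChar G Circle) x ∈ W

theorem isEquicontinuous_of_eventually_circlePlus {ν τ : TopologicalSpace G}
    (hν : @IsTopologicalAddGroup G ν _) {B : Set (contDual τ)}
    (h : ∀ᶠ x in @nhds G ν 0, ∀ χ ∈ B, (χ : AddChar G Circle) x ∈ circlePlus) :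
    IsEquicontinuous ν B := by
  intro W hW
  have := @eventually_of_eventually_circlePlus G _ ν hν B (fun χ => χ.1.1) (by simpa using h) W hW
  simpa using this

theorem IsEquicontinuous.add {ν τ : TopologicalSpace G} {A B : Set (contDual τ)}
    (hA : IsEquicontinuous ν A) (hB : IsEquicontinuous ν B) : IsEquicontinuous ν (A + B) := by
  intro W hW
  obtain ⟨V, hV, hVW⟩ := exists_nhds_one_split hW
  filter_upwards [hA V hV, hB V hV] with x hx hy
  rintro _ ⟨χ, hχ, η, hη, rfl⟩
  exact hVW _ (hx χ hχ) _ (hy η hη)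

theorem isEquicontinuous_zero {ν τ : TopologicalSpace G} :
    IsEquicontinuous ν ({0} : Set (contDual τ)) := by
  intro W hW
  refine Eventually.of_forall fun x χ hχ => ?_
  rw [Set.mem_singleton_iff.1 hχ]
  exact mem_of_mem_nhds hW

theorem IsEquicontinuous.nfoldSum {ν τ : TopologicalSpace G} {A : Set (contDual τ)}
    (hA : IsEquicontinuous ν A) (n : ℕ) : IsEquicontinuous ν (nfoldSum A n) := by
  induction n with
  | zero => exact isEquicontinuous_zero
  | succ n ih => exact ih.add hA

theorem isEquicontinuous_of_finite {ν τ : TopologicalSpace G} (h : contDual τ ≤ contDual ν)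
    {F : Set (contDual τ)} (hF : F.Finite) : IsEquicontinuous ν F := by
  intro W hW
  refine (eventually_all_finite hF).2 fun χ _ => ?_
  have h1 : @Continuous G Circle ν _ (χ : AddChar G Circle) := h χ.2
  exact (@Continuous.continuousAt G Circle ν _ _ 0 h1).eventually (by simpa using hW)

/-- The polar is `ν`-equicontinuous, hence so is `(n)K + F`. Its inverse polar is then a
`ν`-neighborhood of `0`, and every character sending that into `𝕊₊` is `ν`-continuous. -/
theorem polar_mem_Mac {τ ν : TopologicalSpace G}
    (hν : @IsTopologicalAddGroup G ν _) (hdual : contDual ν = contDual τ) {U : Set G}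
    (hU : U ∈ @nhds G ν 0) :
    {χ : contDual τ | ∀ g ∈ U, (χ : AddChar G Circle) g ∈ circlePlus} ∈ Mac τ := by
  refine ⟨fun χ hχ => ?_, isCompact_polar hν hdual hU, fun F hF _ n _ χ hχ => ?_⟩
  · simp only [Set.mem_ofPred_eq, not_forall] at hχ
    obtain ⟨g, hg, hχ⟩ := hχ
    exact ⟨evalChar τ g, evalChar_mem τ g, hχ, fun η hη => hη g hg⟩
  · have hK : IsEquicontinuous ν
        {χ : contDual τ | ∀ g ∈ U, (χ : AddChar G Circle) g ∈ circlePlus} :=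
      isEquicontinuous_of_eventually_circlePlus hν (mem_of_superset hU fun x hx χ hχ => hχ x hx)
    have h := (hK.nfoldSum n).add (isEquicontinuous_of_finite hdual.ge hF) _ circlePlus_mem_nhds
    rw [← hdual]
    exact @continuous_addChar G _ ν hν χ (h.mono fun x hx => hχ x hx)

theorem nhds_eq_map_add_left [TopologicalSpace G] [IsTopologicalAddGroup G] (x : G) :
    𝓝 x = map (x + ·) (𝓝 0) :=
  (map_add_left_nhds_zero x).symm

/-- A locally quasi-convex group is a Mackey group if the members of `Mac` have inverse polars that
are neighborhoods of zero. -/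
theorem isMackeyGroup_of_forall_mem_Mac {τ : TopologicalSpace G} (hτ : IsLQC τ)
    (h : ∀ K ∈ Mac τ, invPolar K ∈ @nhds G τ 0) : IsMackeyGroup τ := by
  refine ⟨hτ, fun ν hν hdual => ?_⟩
  have hle : @nhds G τ 0 ≤ @nhds G ν 0 := by
    intro V hV
    obtain ⟨U, hU, hUqc, hUV⟩ := hν.quasiConvex_basis V hV
    refine mem_of_superset (h _ (polar_mem_Mac hν.1 hdual hU)) fun x hx => hUV ?_
    by_contra hxU
    obtain ⟨χ, hχ, hχx, hχU⟩ := hUqc x hxU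
    exact hχx (hx ⟨χ, hdual ▸ hχ⟩ hχU)
  have h1 := hτ.1
  have h2 := hν.1
  refine le_of_nhds_le_nhds fun x => ?_
  rw [@nhds_eq_map_add_left G _ τ h1 x, @nhds_eq_map_add_left G _ ν h2 x]
  exact map_mono hle

end Groups

/-! ### Real lifts of circle values -/

theorem exp_mem_circlePlus_iff {a : ℝ} :
    Circle.exp (2 * Real.pi * a) ∈ circlePlus ↔ 0 ≤ Real.cos (2 * Real.pi * a) := by
  simp only [circlePlus, Set.mem_ofPred_eq, Circle.coe_exp, Complex.exp_ofReal_mul_I_re]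

theorem exp_mem_circlePlus_of_abs_le {a : ℝ} (ha : |a| ≤ 1 / 4) :
    Circle.exp (2 * Real.pi * a) ∈ circlePlus := by
  have := Real.pi_pos
  rw [exp_mem_circlePlus_iff]
  obtain ⟨h1, h2⟩ := abs_le.1 ha
  apply Real.cos_nonneg_of_neg_pi_div_two_le_of_le <;> nlinarith

theorem exp_notMem_circlePlus {a : ℝ} (h1 : 1 / 4 < a) (h2 : a ≤ 1 / 2) :
    Circle.exp (2 * Real.pi * a) ∉ circlePlus := by
  have := Real.pi_pos
  rw [exp_mem_circlePlus_iff, not_le]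
  apply Real.cos_neg_of_pi_div_two_lt_of_lt <;> nlinarith

/-- Scaling defeats periodicity: if `|a| > 1/4`, some `t * a` with `|t| ≤ 1` lands in `(1/4, 1/2]`,
where the cosine is negative. -/
theorem abs_le_of_forall_exp_mem_circlePlus {a : ℝ}
    (h : ∀ t : ℝ, |t| ≤ 1 → Circle.exp (2 * Real.pi * (t * a)) ∈ circlePlus) : |a| ≤ 1 / 4 := by
  by_contra! ha
  have ha0 : a ≠ 0 := by
    rintro rfl
    norm_num at ha
  have hb : 0 < min |a| (1 / 2) := lt_min (by positivity) (by norm_num)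
  have hmem := h (min |a| (1 / 2) / a) (by
    rw [abs_div, abs_of_pos hb]
    exact div_le_one_of_le₀ (min_le_left _ _) (abs_nonneg _))
  rw [div_mul_cancel₀ _ ha0] at hmem
  exact exp_notMem_circlePlus (lt_min ha (by norm_num)) (min_le_right _ _) hmem

/-- The two sides differ by `2πm`, while three arguments of size at most `π/2` leave a gap of at
most `3π/2`; so `m = 0`. -/
theorem arg_add_of_mem {E : Type*} [AddCommGroup E] {χ : AddChar E Circle} {x y : E} (hx : χ x ∈ circlePlus)
    (hy : χ y ∈ circlePlus) (hxy : χ (x + y) ∈ circlePlus) :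
    Complex.arg (χ (x + y)) = Complex.arg (χ x) + Complex.arg (χ y) := by
  have h : Circle.exp (Complex.arg (χ (x + y))) =
      Circle.exp (Complex.arg (χ x) + Complex.arg (χ y)) := by
    rw [Circle.exp_add, Circle.exp_arg, Circle.exp_arg, Circle.exp_arg, AddChar.map_add_eq_mul]
  obtain ⟨m, hm⟩ := Circle.exp_eq_exp.1 h
  have h1 := abs_le.1 (Complex.abs_arg_le_pi_div_two_iff.2 hx)
  have h2 := abs_le.1 (Complex.abs_arg_le_pi_div_two_iff.2 hy)
  have h3 := abs_le.1 (Complex.abs_arg_le_pi_div_two_iff.2 hxy)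
  have hπ := Real.pi_pos
  have hm1 : (m : ℝ) < 1 := by
    by_contra! hc
    nlinarith
  have hm2 : (-1 : ℝ) < m := by
    by_contra! hc
    nlinarith
  have hm0 : m = 0 := by
    have : m < 1 := by exact_mod_cast hm1
    have : -1 < m := by exact_mod_cast hm2
    omega
  simpa [hm0] using hm

/-! ### Lifting characters to linear functionals -/

section Characters

variable {E : Type*} [AddCommGroup E] [Module ℝ E] [TopologicalSpace E] [IsTopologicalAddGroup E]
  [ContinuousSMul ℝ E]

/-- Continuous characters of a real topological vector space lift to continuous linear
functionals. -/
theorem exists_linearMap_of_continuous_addChar {χ : AddChar E Circle} (hχ : Continuous χ) :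
    ∃ f : E →ₗ[ℝ] ℝ, Continuous f ∧ ∀ x, χ x = Circle.exp (2 * Real.pi * f x) := by
  have hnhds : {x | χ x ∈ circlePlus} ∈ 𝓝 (0 : E) := eventually_circlePlus_of_mem_contDual hχ
  obtain ⟨U, ⟨hU, hbal⟩, hUχ⟩ := (nhds_basis_balanced ℝ E).mem_iff.1 hnhds
  let g : E → ℝ := fun x => Complex.arg (χ x)
  have hadd : ∀ x y, x ∈ U → y ∈ U → x + y ∈ U → g (x + y) = g x + g y :=
    fun x y hx hy hxy => arg_add_of_mem (hUχ hx) (hUχ hy) (hUχ hxy)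
  have hhalf : ∀ m : ℕ, ∀ x ∈ U, ((1 / 2 : ℝ) ^ m) • x ∈ U := fun m x hx =>
    hbal.smul_mem (by
      rw [norm_pow]
      exact pow_le_one₀ (norm_nonneg _) (by norm_num)) hx
  have hscale : ∀ m : ℕ, ∀ x ∈ U, 2 ^ m * g (((1 / 2 : ℝ) ^ m) • x) = g x := by
    intro m x hx
    induction m with
    | zero => simp
    | succ m ih =>
      have h1 : ((1 / 2 : ℝ) ^ m) • x =
          ((1 / 2 : ℝ) ^ (m + 1)) • x + ((1 / 2 : ℝ) ^ (m + 1)) • x := by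
        rw [← add_smul]
        congr 1
        ring
      have h2 := hadd _ _ (hhalf (m + 1) x hx) (hhalf (m + 1) x hx) (h1 ▸ hhalf m x hx)
      rw [← ih, h1, h2]
      ring
  have habs : ∀ x, ∃ n : ℕ, ((1 / 2 : ℝ) ^ n) • x ∈ U := by
    intro x
    have h1 : Tendsto (fun n : ℕ => ((1 / 2 : ℝ) ^ n) • x) atTop (𝓝 0) := by
      have := (tendsto_pow_atTop_nhds_zero_of_lt_one (r := (1 / 2 : ℝ)) (by norm_num)
        (by norm_num)).smul_const x
      simpa using this
    exact (h1.eventually hU).exists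
  choose n hn using habs
  -- The local lift `g` is extended to all of `E` by homogeneity; `hscale` makes the value
  -- independent of the exponent, once the scaled point lies in `U`.
  let f : E → ℝ := fun x => 2 ^ n x * g (((1 / 2 : ℝ) ^ n x) • x)
  have hf : ∀ x, ∀ m ≥ n x, f x = 2 ^ m * g (((1 / 2 : ℝ) ^ m) • x) ∧
      ((1 / 2 : ℝ) ^ m) • x ∈ U := by
    intro x m hm
    obtain ⟨k, rfl⟩ := Nat.exists_eq_add_of_le hm
    have h1 : ((1 / 2 : ℝ) ^ (n x + k)) • x = ((1 / 2 : ℝ) ^ k) • ((1 / 2 : ℝ) ^ n x) • x := by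
      rw [smul_smul]
      congr 1
      ring
    refine ⟨?_, h1 ▸ hhalf k _ (hn x)⟩
    change 2 ^ n x * g _ = _
    rw [h1, ← hscale k _ (hn x)]
    ring
  have hfadd : ∀ x y, f (x + y) = f x + f y := by
    intro x y
    -- One exponent that is large enough for `x`, `y` and `x + y`.
    obtain ⟨h1, h1'⟩ := hf x (n x + n y + n (x + y)) (by omega)
    obtain ⟨h2, h2'⟩ := hf y (n x + n y + n (x + y)) (by omega)
    obtain ⟨h3, h3'⟩ := hf (x + y) (n x + n y + n (x + y)) (by omega)
    rw [smul_add] at h3 h3'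
    rw [h1, h2, h3, hadd _ _ h1' h2' h3']
    ring
  have hfg : ∀ x ∈ U, f x = g x := fun x hx => hscale _ x hx
  have hexp : ∀ x, χ x = Circle.exp (f x) := by
    intro x
    have h1 : x = (2 ^ n x) • (((1 / 2 : ℝ) ^ n x) • x) := by
      rw [← Nat.cast_smul_eq_nsmul ℝ, smul_smul]
      push_cast
      rw [← mul_pow]
      norm_num
    have h2 : f x = ((2 ^ n x : ℕ) : ℝ) * g (((1 / 2 : ℝ) ^ n x) • x) := by
      push_cast
      rfl
    conv_lhs => rw [h1, AddChar.map_nsmul_eq_pow, ← Circle.exp_arg (χ _)]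
    rw [h2, ← nsmul_eq_mul, Circle.exp_nsmul]
  let F : E →+ ℝ := AddMonoidHom.mk' f hfadd
  have hF : Continuous F := by
    refine continuous_of_continuousAt_zero F ?_
    have hg : ContinuousAt g 0 := by
      have h1 : ContinuousAt Complex.arg ((χ 0 : Circle) : ℂ) := by
        rw [AddChar.map_zero_eq_one]
        exact Complex.continuousAt_arg (by simp)
      exact ContinuousAt.comp' (f := fun x => ((χ x : Circle) : ℂ)) h1
        (continuous_subtype_val.comp hχ).continuousAt
    exact hg.congr (mem_of_superset hU fun x hx => (hfg x hx).symm)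
  -- Continuity upgrades additivity to real linearity.
  refine ⟨(2 * Real.pi)⁻¹ • (F.toRealLinearMap hF).toLinearMap, hF.const_smul _, fun x => ?_⟩
  rw [hexp]
  congr 1
  have : (2 * Real.pi) ≠ 0 := by positivity
  change f x = 2 * Real.pi * ((2 * Real.pi)⁻¹ * f x)
  field_simp

end Characters

/-! ### Locally convex spaces are locally quasi-convex -/

section LocallyConvex

variable {E : Type*} [AddCommGroup E] [Module ℝ E] [μ : TopologicalSpace E]

theorem psi_apply (f : WeakDual ℝ E) (x : E) :
    (psi f : AddChar E Circle) x = Circle.exp (2 * Real.pi * f x) := rfl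

variable [IsTopologicalAddGroup E] [ContinuousSMul ℝ E]

theorem exists_psi_eq (χ : contDual μ) : ∃ f : WeakDual ℝ E, psi f = χ := by
  obtain ⟨f, hf', hf⟩ := exists_linearMap_of_continuous_addChar χ.2
  refine ⟨(⟨f, hf'⟩ : E →L[ℝ] ℝ), Subtype.ext (DFunLike.ext _ _ fun x => ?_)⟩
  exact (hf x).symm

theorem exists_psi_eq_of_balanced {χ : contDual μ} {U : Set E} (hU : Balanced ℝ U)
    (hχ : ∀ x ∈ U, (χ : AddChar E Circle) x ∈ circlePlus) :
    ∃ f : WeakDual ℝ E, (∀ x ∈ U, |f x| ≤ 1 / 4) ∧ psi f = χ := by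
  obtain ⟨f, rfl⟩ := exists_psi_eq χ
  refine ⟨f, fun x hx => abs_le_of_forall_exp_mem_circlePlus fun t ht => ?_, rfl⟩
  have := hχ _ (hU.smul_mem (show ‖t‖ ≤ 1 from ht) hx)
  rwa [psi_apply, map_smul, smul_eq_mul] at this

theorem exists_one_lt_of_notMem [LocallyConvexSpace ℝ E] {U : Set E} (hU : U ∈ 𝓝 (0 : E))
    (hc : AbsConvex ℝ U) (hcl : IsClosed U) {x : E} (hx : x ∉ U) :
    ∃ f : WeakDual ℝ E, (∀ y ∈ U, |f y| ≤ 1) ∧ 1 < f x := by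
  obtain ⟨f, u, hf, hfx⟩ := geometric_hahn_banach_closed_point hc.2 hcl hx
  have hu : 0 < u := by simpa using hf 0 (mem_of_mem_nhds hU)
  have key : ∀ y ∈ U, f y ≤ u := fun y hy => (hf y hy).le
  refine ⟨u⁻¹ • f, fun y hy => ?_, ?_⟩
  · change |u⁻¹ * f y| ≤ 1
    rw [abs_mul, abs_of_pos (inv_pos.2 hu), inv_mul_le_one₀ hu]
    refine abs_le'.2 ⟨key y hy, ?_⟩
    rw [← map_neg]
    exact key _ (hc.1.neg_mem_iff.2 hy)
  · change 1 < u⁻¹ * f x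
    rwa [lt_inv_mul_iff₀ hu, mul_one]

theorem isQuasiConvex_of_absConvex [LocallyConvexSpace ℝ E] {U : Set E} (hU : U ∈ 𝓝 (0 : E))
    (hc : AbsConvex ℝ U) (hcl : IsClosed U) : IsQuasiConvex μ U := by
  intro x hx
  obtain ⟨f, hf, hfx⟩ := exists_one_lt_of_notMem hU hc hcl hx
  -- `t ≤ 1/4` keeps `U` inside `𝕊₊`; the upper bound `1/2` stops a large `f x` from winding back
  -- into it.
  have ht : ∃ t : ℝ, 0 ≤ t ∧ t ≤ 1 / 4 ∧ 1 / 4 < t * f x ∧ t * f x ≤ 1 / 2 := by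
    by_cases h : f x ≤ 2
    · exact ⟨1 / 4, by norm_num, le_rfl, by linarith, by linarith⟩
    · push Not at h
      have h0 : f x ≠ 0 := by linarith
      refine ⟨1 / (2 * f x), by positivity, ?_, ?_, ?_⟩
      · rw [div_le_div_iff₀ (by linarith) (by norm_num)]
        linarith
      all_goals
        field_simp
        norm_num
  obtain ⟨t, ht0, ht1, ht2, ht3⟩ := ht
  refine ⟨psi (t • f), (psi (t • f)).2, ?_, fun y hy => ?_⟩
  · rw [psi_apply]
    exact exp_notMem_circlePlus ht2 ht3
  · rw [psi_apply]
    refine exp_mem_circlePlus_of_abs_le ?_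
    change |t * f y| ≤ 1 / 4
    rw [abs_mul, abs_of_nonneg ht0]
    nlinarith [hf y hy, abs_nonneg (f y)]

theorem isLQC_of_locallyConvexSpace [LocallyConvexSpace ℝ E] : IsLQC μ := by
  refine ⟨inferInstance, fun V hV => ?_⟩
  obtain ⟨U, ⟨hU, hc, hcl⟩, hUV⟩ := (nhds_hasBasis_absConvex_closed ℝ E).mem_iff.1 hV
  exact ⟨U, hU, isQuasiConvex_of_absConvex hU hcl hc, hUV⟩

end LocallyConvex

/-! ### Weak-star compactness, polars and the Mackey topology -/

section LocallyConvex

variable {E : Type*} [AddCommGroup E] [Module ℝ E]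

theorem contDual_le_of_forall_continuous {ν τ : TopologicalSpace E}
    (hν : IsLocallyConvexTopology ν)
    (h : ∀ f : E →ₗ[ℝ] ℝ, @Continuous E ℝ ν _ f → @Continuous E ℝ τ _ f) :
    contDual ν ≤ contDual τ := by
  intro χ hχ
  obtain ⟨f, hfc, hf⟩ :=
    @exists_linearMap_of_continuous_addChar E _ _ ν hν.1 hν.2 χ hχ
  have h1 : @Continuous E ℝ τ _ f := h f hfc
  have h2 : (χ : E → Circle) = fun x => Circle.exp (2 * Real.pi * f x) := funext hf
  change @Continuous E Circle τ _ χ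
  rw [h2]
  exact Circle.exp.continuous.comp (continuous_const.mul h1)

variable [μ : TopologicalSpace E]

theorem absConvex_weakDual_polar (U : Set E) (r : ℝ) :
    AbsConvex ℝ {f : WeakDual ℝ E | ∀ x ∈ U, |f x| ≤ r} := by
  refine ⟨balanced_iff_smul_mem.2 fun {t} ht f hf x hx => ?_, fun f hf g hg a b ha hb hab x hx => ?_⟩
  · change |t * f x| ≤ r
    rw [abs_mul]
    exact (mul_le_of_le_one_left (abs_nonneg _) ht).trans (hf x hx)
  · change |a * f x + b * g x| ≤ r
    refine (abs_add_le _ _).trans ?_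
    rw [abs_mul, abs_mul, abs_of_nonneg ha, abs_of_nonneg hb]
    have h1 := mul_le_mul_of_nonneg_left (hf x hx) ha
    have h2 := mul_le_mul_of_nonneg_left (hg x hx) hb
    have h3 : a * r + b * r = r := by rw [← add_mul, hab, one_mul]
    linarith

/-- A linear functional bounded by `1` on the one-sided polar of a weak-star compact convex set
containing zero belongs to this set. -/
theorem exists_eq_of_forall_le_one {D : Set (WeakDual ℝ E)} (hD : IsCompact D)
    (hconv : Convex ℝ D) (hzero : (0 : WeakDual ℝ E) ∈ D) {f : E →ₗ[ℝ] ℝ}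
    (hf : ∀ x, (∀ d ∈ D, d x ≤ 1) → f x ≤ 1) : ∃ d ∈ D, ∀ x, d x = f x := by
  -- Separation takes place in the algebraic dual with pointwise convergence: the compact image of
  -- `D` is closed there, and continuous functionals are evaluations at points of `E`.
  let B : (E →ₗ[ℝ] ℝ) →ₗ[ℝ] E →ₗ[ℝ] ℝ := LinearMap.id
  let ι : WeakDual ℝ E →ₗ[ℝ] WeakBilin B := ContinuousLinearMap.coeLM ℝ
  have hι : Continuous ι :=
    WeakBilin.continuous_of_continuous_eval B fun y => WeakDual.eval_continuous y
  have : T2Space (WeakBilin B) :=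
    (WeakBilin.isEmbedding (B := B) fun _ _ h => h).t2Space
  by_contra! hne
  have hnot : (f : WeakBilin B) ∉ ι '' D := by
    rintro ⟨d, hd, hdf⟩
    obtain ⟨x, hx⟩ := hne d hd
    exact hx (LinearMap.congr_fun (show (ContinuousLinearMap.coeLM ℝ d : E →ₗ[ℝ] ℝ) = f from hdf) x)
  obtain ⟨L, u, hL, hLf⟩ := geometric_hahn_banach_closed_point (hconv.linear_image ι)
    (hD.image hι).isClosed hnot
  obtain ⟨x, rfl⟩ := LinearMap.dualEmbedding_surjective B L
  have hL' : ∀ d ∈ D, d x < u := fun d hd => hL _ ⟨d, hd, rfl⟩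
  have hLf' : u < f x := hLf
  have hu : 0 < u := hL' 0 hzero
  have h1 := hf (u⁻¹ • x) fun d hd => by
    rw [map_smul, smul_eq_mul, inv_mul_le_one₀ hu]
    exact (hL' d hd).le
  rw [map_smul, smul_eq_mul, inv_mul_le_one₀ hu] at h1
  linarith

variable [IsTopologicalAddGroup E] [ContinuousSMul ℝ E]

theorem continuous_of_eventually_abs_le {f : E →ₗ[ℝ] ℝ} {r : ℝ}
    (h : ∀ᶠ x in 𝓝 (0 : E), |f x| ≤ r) : Continuous f := by
  refine (f.clmOfExistsBoundedImage ⟨_, h, ?_⟩).continuous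
  rw [NormedSpace.isVonNBounded_iff]
  refine (Metric.isBounded_closedBall (x := (0 : ℝ)) (r := r)).subset ?_
  rintro _ ⟨x, hx, rfl⟩
  simpa using hx

/-- The Banach-Alaoglu theorem for topological vector spaces. -/
theorem isCompact_weakDual_polar {U : Set E} (hU : U ∈ 𝓝 (0 : E)) (r : ℝ) :
    IsCompact {f : WeakDual ℝ E | ∀ x ∈ U, |f x| ≤ r} := by
  have hind : IsInducing (fun (f : WeakDual ℝ E) (x : E) => f x) := ⟨rfl⟩
  rw [hind.isCompact_iff]
  -- `U` is absorbing, which bounds each coordinate `f x` and places the polar in a product of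
  -- compact intervals.
  have habs : ∀ x : E, ∃ c : ℝ, c ≠ 0 ∧ c • x ∈ U := by
    intro x
    have h1 : Tendsto (fun n : ℕ => ((1 / 2 : ℝ) ^ n) • x) atTop (𝓝 0) := by
      have := (tendsto_pow_atTop_nhds_zero_of_lt_one (r := (1 / 2 : ℝ)) (by norm_num)
        (by norm_num)).smul_const x
      simpa using this
    obtain ⟨n, hn⟩ := (h1.eventually hU).exists
    exact ⟨_, by positivity, hn⟩
  choose c hc0 hc using habs
  have himage : (fun (f : WeakDual ℝ E) (x : E) => f x) '' {f | ∀ x ∈ U, |f x| ≤ r} =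
      (Set.univ.pi fun x => Metric.closedBall (0 : ℝ) (|c x|⁻¹ * r)) ∩
        ((⋂ (x) (y), {φ : E → ℝ | φ (x + y) = φ x + φ y}) ∩
        ((⋂ (t : ℝ) (x), {φ : E → ℝ | φ (t • x) = t * φ x}) ∩
        ⋂ x ∈ U, {φ : E → ℝ | |φ x| ≤ r})) := by
    ext φ
    simp only [Set.mem_image, Set.mem_ofPred_eq, Set.mem_inter_iff, Set.mem_iInter]
    constructor
    · rintro ⟨f, hf, rfl⟩
      refine ⟨fun x _ => ?_, map_add f, map_smul f, hf⟩
      have h1 := hf _ (hc x)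
      rw [map_smul, smul_eq_mul, abs_mul] at h1
      rw [mem_closedBall_zero_iff, Real.norm_eq_abs, ← div_eq_inv_mul,
        le_div_iff₀' (abs_pos.2 (hc0 x))]
      exact h1
    · rintro ⟨-, hadd, hsmul, hU'⟩
      let f : E →ₗ[ℝ] ℝ := ⟨⟨φ, hadd⟩, hsmul⟩
      have hf : Continuous f :=
        continuous_of_eventually_abs_le (mem_of_superset hU fun x hx => hU' x hx)
      exact ⟨(⟨f, hf⟩ : E →L[ℝ] ℝ), hU', rfl⟩
  rw [himage]
  refine (isCompact_univ_pi fun x => isCompact_closedBall _ _).inter_right ?_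
  refine IsClosed.inter ?_ (IsClosed.inter ?_ ?_)
  · refine isClosed_iInter fun x => isClosed_iInter fun y => ?_
    exact isClosed_eq (continuous_apply _) ((continuous_apply x).add (continuous_apply y))
  · refine isClosed_iInter fun t => isClosed_iInter fun x => ?_
    exact isClosed_eq (continuous_apply _) (continuous_const.mul (continuous_apply x))
  · exact isClosed_biInter fun x _ => isClosed_le (continuous_apply x).abs continuous_const

/-- A linear functional that is bounded above on the intersection of a neighborhood of zero with
the polar of a weak-star compact absolutely convex set is continuous. -/
theorem continuous_of_forall_le_one [LocallyConvexSpace ℝ E] {C : Set (WeakDual ℝ E)}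
    (hC : C ∈ CAC E) (hne : C.Nonempty) {f : E →ₗ[ℝ] ℝ} {V : Set E} (hV : V ∈ 𝓝 (0 : E)) {ε : ℝ}
    (hε : 0 < ε) (hf : ∀ x ∈ V, (∀ c ∈ C, |c x| ≤ ε) → f x ≤ 1) : Continuous f := by
  obtain ⟨hcomp, habs⟩ := hC
  have hC0 : (0 : WeakDual ℝ E) ∈ C := habs.1.zero_mem hne
  obtain ⟨U, ⟨hU, hcl, hc⟩, hUV⟩ := (nhds_hasBasis_absConvex_closed ℝ E).mem_iff.1 hV
  have hH0 : (0 : WeakDual ℝ E) ∈ {h : WeakDual ℝ E | ∀ x ∈ U, |h x| ≤ 1} := by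
    intro x _
    change |(0 : ℝ)| ≤ 1
    simp
  -- With `U°` the polar of `U`, the functional `f` is at most `1` on the one-sided polar of the
  -- compact convex set `U° + ε⁻¹C`, so it belongs to that set and is continuous.
  obtain ⟨d, -, hd⟩ := exists_eq_of_forall_le_one (f := f)
    ((isCompact_weakDual_polar hU 1).add (hcomp.smul ε⁻¹))
    ((absConvex_weakDual_polar U 1).2.add (habs.2.smul ε⁻¹))
    (by simpa using Set.add_mem_add hH0 (Set.smul_mem_smul_set (a := ε⁻¹) hC0)) (by
      intro x hx
      have hxU : x ∈ U := by
        by_contra hxU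
        obtain ⟨h, hh, hhx⟩ := exists_one_lt_of_notMem hU hc hcl hxU
        refine (hx h ?_).not_gt hhx
        simpa using Set.add_mem_add (show h ∈ {h : WeakDual ℝ E | ∀ x ∈ U, |h x| ≤ 1} from hh)
          (Set.smul_mem_smul_set (a := ε⁻¹) hC0)
      have hxC : ∀ c ∈ C, c x ≤ ε := by
        intro c hc'
        have h1 : ε⁻¹ * c x ≤ 1 := hx (ε⁻¹ • c) (by
          simpa using Set.add_mem_add hH0 (Set.smul_mem_smul_set (a := ε⁻¹) hc'))
        rwa [inv_mul_le_one₀ hε] at h1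
      refine hf x (hUV hxU) fun c hc' => abs_le'.2 ⟨hxC c hc', ?_⟩
      exact hxC (-c) (habs.1.neg_mem_iff.2 hc'))
  have : (d : E → ℝ) = f := funext hd
  rw [← this]
  exact map_continuous d

/-- In a Mackey space, weak-star compact absolutely convex sets of functionals are
equicontinuous. -/
theorem eventually_abs_le_of_mem_CAC [LocallyConvexSpace ℝ E] (hμ : IsMackeySpace μ)
    {C : Set (WeakDual ℝ E)} (hC : C ∈ CAC E) (hne : C.Nonempty) {r : ℝ} (hr : 0 < r) :
    ∀ᶠ x in 𝓝 (0 : E), ∀ f ∈ C, |f x| ≤ r := by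
  have : CompactSpace C := isCompact_iff_compactSpace.1 hC.1
  let T : E →ₗ[ℝ] C(C, ℝ) :=
    { toFun := fun x => ⟨fun f => f.1 x, (WeakDual.eval_continuous x).comp continuous_subtype_val⟩
      map_add' := fun x y => by
        ext f
        exact map_add f.1 x y
      map_smul' := fun t x => by
        ext f
        exact map_smul f.1 t x }
  have hT : ∀ (x : E) (s : ℝ), 0 ≤ s → (‖T x‖ ≤ s ↔ ∀ f ∈ C, |f x| ≤ s) := by
    intro x s hs
    rw [ContinuousMap.norm_le _ hs]
    exact ⟨fun h f hf => h ⟨f, hf⟩, fun h f => h f.1 f.2⟩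
  -- Adjoining the seminorm `x ↦ sup_C |f x|` to `μ` creates no new continuous functionals, so the
  -- Mackey property makes it `μ`-continuous already.
  have hν : IsLocallyConvexTopology (μ ⊓ TopologicalSpace.induced T inferInstance) :=
    ⟨topologicalAddGroup_inf inferInstance (topologicalAddGroup_induced T),
      @continuousSMul_inf ℝ E _ _ _ _ inferInstance (continuousSMul_induced T),
      LocallyConvexSpace.inf inferInstance (LocallyConvexSpace.induced T)⟩
  have hnhds : @nhds E (μ ⊓ TopologicalSpace.induced T inferInstance) 0 =
      𝓝 0 ⊓ comap T (𝓝 0) := by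
    rw [nhds_inf, nhds_induced, map_zero]
  have hle := hμ.2 _ hν fun f => by
    refine ⟨fun hf => ?_, fun hf => continuous_inf_dom_left hf⟩
    have h0 : ∀ᶠ x in 𝓝 (0 : E) ⊓ comap T (𝓝 0), f x ≤ 1 := by
      have h1 := @Continuous.tendsto E ℝ (_) _ f hf 0
      rw [map_zero, hnhds] at h1
      exact h1.eventually (ge_mem_nhds one_pos)
    obtain ⟨V, hV, W, hW, hVW⟩ := Filter.mem_inf_iff_superset.1 h0
    obtain ⟨W', hW', hW'W⟩ := mem_comap.1 hW
    obtain ⟨ε, hε, hεW⟩ := Metric.nhds_basis_closedBall.mem_iff.1 hW'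
    refine continuous_of_forall_le_one hC hne hV hε fun x hx hxC => hVW ⟨hx, hW'W (hεW ?_)⟩
    rwa [mem_closedBall_zero_iff, hT x ε hε.le]
  have h1 : {x | ‖T x‖ ≤ r} ∈ 𝓝 (0 : E) ⊓ comap T (𝓝 0) := by
    refine mem_inf_of_right ⟨Metric.closedBall 0 r, Metric.closedBall_mem_nhds _ hr, ?_⟩
    intro x hx
    simpa using hx
  rw [← hnhds] at h1
  filter_upwards [nhds_mono hle h1] with x hx
  exact (hT x r hr.le).1 hx

end LocallyConvex
end MackeyGroup

theorem theoremt {E : Type*} [AddCommGroup E] [Module ℝ E] [μ : TopologicalSpace E]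
    [IsTopologicalAddGroup E] [ContinuousSMul ℝ E] [LocallyConvexSpace ℝ E] :
    MackeyGroup.IsMackeyGroup μ ↔
      MackeyGroup.IsMackeySpace μ ∧
        MackeyGroup.Swallows ((fun K : Set (WeakDual ℝ E) => MackeyGroup.psi '' K) '' MackeyGroup.CAC E)
          (MackeyGroup.Mac μ) := by
  open MackeyGroup in
  constructor
  · intro hG
    have hμ : IsLocallyConvexTopology μ := ⟨inferInstance, inferInstance, inferInstance⟩
    refine ⟨⟨hμ, fun ν hν hdual => ?_⟩, fun K hK => ?_⟩
    · refine hG.2 ν (@isLQC_of_locallyConvexSpace E _ _ ν hν.1 hν.2 hν.3) (le_antisymm ?_ ?_)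
      · exact contDual_le_of_forall_continuous hν fun f => (hdual f).1
      · exact contDual_le_of_forall_continuous hμ fun f => (hdual f).2
    · obtain ⟨U, ⟨hU, hbal⟩, hUK⟩ :=
        (nhds_basis_balanced ℝ E).mem_iff.1 (invPolar_mem_nhds_of_mem_Mac hG hK)
      refine ⟨_, ⟨_, ⟨isCompact_weakDual_polar hU (1 / 4), absConvex_weakDual_polar U (1 / 4)⟩,
        rfl⟩, fun χ hχ => ?_⟩
      obtain ⟨f, hf, rfl⟩ := exists_psi_eq_of_balanced hbal fun x hx => hUK hx χ hχ
      exact ⟨f, hf, rfl⟩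
  · rintro ⟨hM, hsw⟩
    refine isMackeyGroup_of_forall_mem_Mac isLQC_of_locallyConvexSpace fun K hK => ?_
    obtain ⟨_, ⟨C, hC, rfl⟩, hKC⟩ := hsw K hK
    -- A quasi-convex set contains `0`, which makes `C` nonempty.
    obtain ⟨f₀, hf₀, -⟩ := hKC (zero_mem_of_isQuasiConvex hK.1)
    filter_upwards [eventually_abs_le_of_mem_CAC hM hC ⟨f₀, hf₀⟩ (show (0 : ℝ) < 1 / 4 by norm_num)]
      with x hx χ hχ
    obtain ⟨f, hf, rfl⟩ := hKC hχ
    rw [psi_apply]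
    exact exp_mem_circlePlus_of_abs_le (hx f hf)
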